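/- Let $\Omega\subset\mathbb{R}^N$ be a bounded domain (nonempty, open and connected) with $C^{1,1}$ boundary, let $d_\Omega(x)$ denote the distance of $x\in\Omega$ to $\partial\Omega$, and let $A,b_0>0$, $\sigma\in(0,2)$, $m>\max\{1,\sigma\}$ and $\theta\in[0,m)$. Write $B_\delta(x)$ for the open ball of center $x$ and radius $\delta$, $B_\delta=B_\delta(0)$ and $B=B_1$. Let $\{\nu_x\}_{x\in\mathbb{R}^N}$ be a family of (nonnegative Borel) measures on $\mathbb{R}^N$ satisfying: (M1) for all $R>0$ and $\alpha\in[0,2]$ there is $C_R>0$ such that, for all $\delta>0$, $\ \sup_{|x|\le R}\int_{B_\delta^c}\min\{1,|z|^\alpha\}\,\nu_x(dz)\le C_R\,h_{\alpha,\sigma}(\delta)$, where $h_{\alpha,\sigma}(\delta)=\delta^{\alpha-\sigma}$ if $\alpha<\sigma$, $h_{\alpha,\sigma}(\delta)=|\ln\delta|+1$ if $\alpha=\sigma$, $h_{\alpha,\sigma}(\delta)=1$ if $\alpha>\sigma$; (M2) for all $R>0$ and $\alpha\in(\sigma,2]$ there is $C_R>0$ such that, for all $\delta\in(0,1)$, $\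 \sup_{|x|\le R}\int_{B_\delta}|z|^\alpha\,\nu_x(dz)\le C_R\,\delta^{\alpha-\sigma}$. For a Borel set $S$ and $p\in\mathbb{R}^N$ put $I_x[S](\phi,x,p)=\int_S[\phi(x+z)-\phi(x)-\mathbf 1_B(z)\langle p,z\rangle]\,\nu_x(dz)$ if $\sigma\ge1$, and $I_x[S](\phi,x,p)=\int_S[\phi(x+z)-\phi(x)]\,\nu_x(dz)$ if $\sigma<1$; let $I_x(\phi,x)=I_x[\mathbb{R}^N](\phi,x,D\phi(x))$. Assume that the operator is censored with respect to $\Omega$: for every $x\in\Omega$, $\nu_x(\{z: x+z\notin\Omega\})=0$ (this is the case in particular if $\Omega_\nu=\Omega$, where $\Omega_\nu=\Omega\cup\bigcup_{x\in\overline\Omega}(x+\operatorname{supp}\nu_x)$). A function $u:\mathbb{R}^N\to\mathbb{R}$ is a viscosity subsolution of $$-I_x(u,x)+b_0|Du(x)|^m=A\,(d_\Omega(x)^{-\theta}+1),\qquad x\in\Omega, \tag{P'}$$ if it is upper semicontinuous in $\Omega$ and, whenever $x\in\Omega$, $\delta>0$, $B_\delta(x)\subset\Omega$, $\varphi\in C^2(\mathbb{R}^N)$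 and $u-\varphi$ has a maximum over $B_\delta(x)$ at $x$, one has $$-I_x[B_\delta](\varphi,x,D\varphi(x))-I_x[B_\delta^c](u,x,D\varphi(x))+b_0|D\varphi(x)|^m\le A\,(d_\Omega(x)^{-\theta}+1).$$ Then there exists $K>0$, independent of $u$, such that every viscosity subsolution $u$ of (P') that is bounded on $\Omega$ satisfies $$\operatorname{osc}_\Omega u=\sup_\Omega u-\inf_\Omega u\le K.$$ -/

import Mathlib

open MeasureTheory Set Metric
open scoped NNReal ENNReal

noncomputable section

/-- The oscillation of `u` over `Ω`, i.e. the supremum minus the infimum. -/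
def osc {X : Type*} (Ω : Set X) (u : X → ℝ) : ℝ :=
  sSup (u '' Ω) - sInf (u '' Ω)

/-- `Ω` has a `C^{1,1}` boundary: near each boundary point, `Ω` is the region strictly above the
graph of a `C^1` function with Lipschitz derivative, with respect to some unit direction `e`.
The vector `y - ⟪e, y⟫ e` is the orthogonal projection of `y` to the hyperplane `e^⊥`, so only
the restriction of `g` to `e^⊥` is used. -/
def HasC11Boundary {N : ℕ} (Ω : Set (EuclideanSpace ℝ (Fin N))) : Prop :=
  ∀ x₀ ∈ frontier Ω, ∃ r > (0 : ℝ), ∃ e : EuclideanSpace ℝ (Fin N), ‖e‖ = 1 ∧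
    ∃ g : EuclideanSpace ℝ (Fin N) → ℝ, ContDiff ℝ 1 g ∧
      (∃ L : ℝ≥0, LipschitzWith L (fderiv ℝ g)) ∧
      ∀ y ∈ ball x₀ r, y ∈ Ω ↔ g (y - inner ℝ e y • e) < inner ℝ e y

/-- The function `h_{α,σ}(δ)`, for `δ > 0`. -/
def hFun (α σ δ : ℝ) : ℝ :=
  if α < σ then δ ^ (α - σ) else if α = σ then |Real.log δ| + 1 else 1

/-- Assumption (M1) on the family of measures `ν`, relative to `σ`. -/
def CondM1 {N : ℕ} (σ : ℝ) (ν : EuclideanSpace ℝ (Fin N) → Measure (EuclideanSpace ℝ (Fin N))) :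
    Prop :=
  ∀ R > (0 : ℝ), ∀ α ∈ Icc (0 : ℝ) 2, ∃ C > (0 : ℝ), ∀ δ > (0 : ℝ), ∀ x ∈ closedBall 0 R,
    ∫⁻ z in (ball 0 δ)ᶜ, ENNReal.ofReal (min 1 (‖z‖ ^ α)) ∂(ν x) ≤ ENNReal.ofReal (C * hFun α σ δ)

/-- Assumption (M2) on the family of measures `ν`, relative to `σ`. -/
def CondM2 {N : ℕ} (σ : ℝ) (ν : EuclideanSpace ℝ (Fin N) → Measure (EuclideanSpace ℝ (Fin N))) :
    Prop :=
  ∀ R > (0 : ℝ), ∀ α ∈ Ioc σ 2, ∃ C > (0 : ℝ), ∀ δ ∈ Ioo (0 : ℝ) 1, ∀ x ∈ closedBall 0 R,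
    ∫⁻ z in ball 0 δ, ENNReal.ofReal (‖z‖ ^ α) ∂(ν x) ≤ ENNReal.ofReal (C * δ ^ (α - σ))

/-- The part over `S` of the nonlocal operator at `x`, with the measure `μ` and with `p` in the
place of the gradient of `φ`: the integral over `S` of `φ(x+z) - φ(x) - 1_B(z) ⟪p, z⟫` (where `B`
is the open unit ball) if `σ ≥ 1`, and of `φ(x+z) - φ(x)` if `σ < 1`. -/
def nonlocalOp {N : ℕ} (σ : ℝ) (μ : Measure (EuclideanSpace ℝ (Fin N)))
    (S : Set (EuclideanSpace ℝ (Fin N))) (φ : EuclideanSpace ℝ (Fin N) → ℝ)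
    (x p : EuclideanSpace ℝ (Fin N)) : ℝ :=
  ∫ z in S, (φ (x + z) - φ x -
    if 1 ≤ σ then (ball (0 : EuclideanSpace ℝ (Fin N)) 1).indicator (fun w => inner ℝ p w) z
    else 0) ∂μ

/-- `u` is a viscosity subsolution in `Ω` of
`-I_x(u, x) + b₀ |Du(x)|^m = A (d_Ω(x)^{-θ} + 1)`:
it is upper semicontinuous in `Ω`, and whenever `u - φ` has a maximum over the ball `B_δ(x) ⊆ Ω`
at its center, with `φ` of class `C^2`, the inequality holds at `x` with `φ` in the gradient term
and in the nonlocal integral over `B_δ`, and with `u` in the nonlocal integral over the complement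
of `B_δ`. -/
def IsViscositySubsolution {N : ℕ} (Ω : Set (EuclideanSpace ℝ (Fin N))) (σ m θ A b₀ : ℝ)
    (ν : EuclideanSpace ℝ (Fin N) → Measure (EuclideanSpace ℝ (Fin N)))
    (u : EuclideanSpace ℝ (Fin N) → ℝ) : Prop :=
  UpperSemicontinuousOn u Ω ∧
  ∀ x ∈ Ω, ∀ δ > (0 : ℝ), ball x δ ⊆ Ω →
    ∀ φ : EuclideanSpace ℝ (Fin N) → ℝ, ContDiff ℝ 2 φ →
      IsMaxOn (fun y => u y - φ y) (ball x δ) x →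
      -(nonlocalOp σ (ν x) (ball 0 δ) φ x (gradient φ x)
          + nonlocalOp σ (ν x) (ball 0 δ)ᶜ u x (gradient φ x))
        + b₀ * ‖gradient φ x‖ ^ m
        ≤ A * ((infDist x (frontier Ω)) ^ (-θ) + 1)

/-- The operator is censored relative to `Ω`: from a point of `Ω` there are no jumps to the
complement of `Ω`. -/
def IsCensored {N : ℕ} (Ω : Set (EuclideanSpace ℝ (Fin N)))
    (ν : EuclideanSpace ℝ (Fin N) → Measure (EuclideanSpace ℝ (Fin N))) : Prop :=
  ∀ x ∈ Ω, ν x {z | x + z ∉ Ω} = 0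

/-- The set `Ω_ν` reachable from `Ω` through the (closed) supports of the measures `ν x`. -/
def reachableSet {N : ℕ} (Ω : Set (EuclideanSpace ℝ (Fin N)))
    (ν : EuclideanSpace ℝ (Fin N) → Measure (EuclideanSpace ℝ (Fin N))) :
    Set (EuclideanSpace ℝ (Fin N)) :=
  Ω ∪ ⋃ x ∈ closure Ω, (fun z => x + z) '' (ν x).support

/-- The condition `Ω_ν = Ω` implies that the operator is censored. The converse fails for
`ν x = 1_{Ω - x}(z) |z|^{-N-σ} dz`, whose closed support is not contained in `Ω - x`. -/
theorem IsCensored.of_reachableSet_eq {N : ℕ} {Ω : Set (EuclideanSpace ℝ (Fin N))}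
    {ν : EuclideanSpace ℝ (Fin N) → Measure (EuclideanSpace ℝ (Fin N))}
    (h : reachableSet Ω ν = Ω) : IsCensored Ω ν := by
  intro x hx
  refine measure_mono_null (t := (ν x).supportᶜ) (fun z hz hzs => hz ?_)
    Measure.measure_compl_support
  rw [← h]
  exact Or.inr (mem_biUnion (subset_closure hx) ⟨z, hzs, rfl⟩)

end

/-! The gradient term forces an interior Hölder estimate whose constant grows only sublinearly with
the oscillation `M` of `u`. Suppose the estimate fails in a ball inside `Ω`. Then a barrier that
vanishes at the center and blows up on the sphere touches `u` from above, which gives a paraboloid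
of slope `p` on a ball of radius `δ` with `‖p‖` at least of order `L * δ ^ (γ - 1)`
(`exists_touching_paraboloid`). Since the operator is censored, `u` enters the nonlocal term only
through its values in `Ω`, so jumps longer than `δ` contribute at most order `M * δ ^ (-σ)` plus a
compensator linear in `‖p‖` (`exists_gradient_inequality`). With `γ = 1 - max σ θ / m`, which is
positive because `σ, θ < m`, and `L` of order `(1 + M) ^ (1 / m)`, the term `b₀ * ‖p‖ ^ m` exceeds
all the others, a contradiction.

The geometry of `Ω` turns this into `M ≤ K * L`: connectedness links interior points, and near the
boundary the errors `L * r ^ γ` form a geometric series along a cone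
(`exists_bound_of_interiorHolder`). Hence `M` is bounded by a constant times `(1 + M) ^ (1 / m)`; as
`M` is finite and `m > 1`, it is bounded independently of `u`. -/

/-! ### From interior Hölder estimates to oscillation bounds -/

/-- `u` satisfies a `γ`-Hölder estimate with constant `L` on pairs of points of `Ω` whose distance
is small compared to their distance to the boundary. -/
def InteriorHolder {E : Type*} [PseudoMetricSpace E] (Ω : Set E) (γ L : ℝ) (u : E → ℝ) : Prop :=
  ∀ x y : E, ∀ r : ℝ, 0 < r → r ≤ 1 → ball x (2 * r) ⊆ Ω → ball y (2 * r) ⊆ Ω →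
    dist x y ≤ r / 2 → |u x - u y| ≤ L * r ^ γ

theorem InteriorHolder.abs_sub_le {E : Type*} [PseudoMetricSpace E] {Ω : Set E} {γ L : ℝ}
    {u : E → ℝ} (h : InteriorHolder Ω γ L u) (hγ : 0 ≤ γ) (hL : 0 ≤ L) {x y : E} {r : ℝ}
    (hr : 0 < r) (hr1 : r ≤ 1) (hx : ball x (2 * r) ⊆ Ω) (hy : ball y (2 * r) ⊆ Ω)
    (hxy : dist x y ≤ r / 2) : |u x - u y| ≤ L :=
  (h x y r hr hr1 hx hy hxy).trans
    (mul_le_of_le_one_right hL (Real.rpow_le_one hr.le hr1 hγ))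

theorem IsOpen.exists_ball_eventually_subset {E : Type*} [PseudoMetricSpace E] {Ω : Set E}
    (hΩ : IsOpen Ω) {x : E} (hx : x ∈ Ω) :
    ∃ r, 0 < r ∧ r ≤ 1 ∧ ∀ y, dist y x ≤ r / 2 → ball y (2 * r) ⊆ Ω := by
  obtain ⟨R, hR, hRΩ⟩ := Metric.isOpen_iff.1 hΩ x hx
  refine ⟨min 1 (R / 4), by positivity, min_le_left _ _, fun y hy => ?_⟩
  refine (ball_subset_ball' ?_).trans hRΩ
  have := min_le_right 1 (R / 4)
  linarith

/-- Nearby points satisfy such a bound with factor 1, and bounds add along chains; connectedness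
does the rest. `K` may depend on the two points but not on `u`. -/
theorem exists_bound_of_interiorHolder_of_mem {E : Type*} [PseudoMetricSpace E] {Ω : Set E}
    (hΩ : IsOpen Ω) (hc : IsPreconnected Ω) {γ : ℝ} (hγ : 0 ≤ γ) {x y : E} (hx : x ∈ Ω)
    (hy : y ∈ Ω) :
    ∃ K : ℝ, ∀ (u : E → ℝ) (L : ℝ), 0 ≤ L → InteriorHolder Ω γ L u → |u x - u y| ≤ K * L := by
  refine hc.induction₂ (fun x y => ∃ K : ℝ, ∀ (u : E → ℝ) (L : ℝ), 0 ≤ L →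
    InteriorHolder Ω γ L u → |u x - u y| ≤ K * L) ?_ ?_ ?_ hx hy
  · intro x hx
    obtain ⟨r, hr, hr1, h⟩ := hΩ.exists_ball_eventually_subset hx
    filter_upwards [mem_nhdsWithin_of_mem_nhds (closedBall_mem_nhds x (half_pos hr))] with y hy
    refine ⟨1, fun u L hL hu => ?_⟩
    rw [one_mul]
    exact hu.abs_sub_le hγ hL hr hr1 (h x (by rw [dist_self]; positivity)) (h y hy)
      (by rw [dist_comm]; exact hy)
  · rintro x y z - - - ⟨K, hK⟩ ⟨K', hK'⟩
    refine ⟨K + K', fun u L hL hu => ?_⟩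
    linarith [abs_sub_le (u x) (u y) (u z), hK u L hL hu, hK' u L hL hu]
  · rintro x y - - ⟨K, hK⟩
    exact ⟨K, fun u L hL hu => by rw [abs_sub_comm]; exact hK u L hL hu⟩

/-- Along a segment that leaves a point of an open set inside a cone contained in the set, the
variation of a function with an interior Hölder estimate is controlled. -/
theorem exists_bound_of_cone {c s γ : ℝ} (hc : 0 < c) (hc1 : c ≤ 1) (hs : 0 < s)
    (hs1 : s ≤ 1) (hγ : 0 < γ) :
    ∃ K : ℝ, ∀ {E : Type} [NormedAddCommGroup E] [NormedSpace ℝ E] {Ω : Set E},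
      IsOpen Ω → ∀ {y e : E}, y ∈ Ω → ‖e‖ = 1 →
      (∀ t, 0 < t → t ≤ s → ball (y + t • e) (c * t) ⊆ Ω) →
      ∀ (u : E → ℝ) (L : ℝ), 0 ≤ L → InteriorHolder Ω γ L u → |u (y + s • e) - u y| ≤ K * L := by
  -- Passing from parameter `t` to `q * t` moves by `c * t / 8`, half of the admissible scale `c * t
  -- / 4`; since `q ≥ 7 / 8`, the ball needed around the new point still fits in its cone ball.
  set q : ℝ := 1 - c / 8 with hq
  have hq0 : 0 < q := by linarith
  have hq1 : q < 1 := by linarith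
  have hqγ1 : q ^ γ < 1 := Real.rpow_lt_one hq0.le hq1 hγ
  have hqγ0 : 0 < q ^ γ := Real.rpow_pos_of_pos hq0 γ
  refine ⟨1 / (1 - q ^ γ) + 1, ?_⟩
  intro E _ _ Ω hΩ y e hy he hcone u L hL hu
  have hstep : ∀ t, 0 < t → t ≤ s → |u (y + t • e) - u (y + (q * t) • e)| ≤ L * t ^ γ := by
    intro t ht hts
    have hct : c * t ≤ t := mul_le_of_le_one_left ht.le hc1
    have hct0 : 0 < c * t := by positivity
    have hqt : q * t = t - c * t / 8 := by rw [hq]; ring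
    refine (hu _ _ (c * t / 4) (by positivity) (by linarith) ?_ ?_ ?_).trans ?_
    · exact (ball_subset_ball (by linarith)).trans (hcone t ht hts)
    · refine (ball_subset_ball ?_).trans
        (hcone (q * t) (by positivity) (by nlinarith))
      nlinarith
    · rw [dist_eq_norm, add_sub_add_left_eq_sub, ← sub_smul, norm_smul, he, hqt, Real.norm_eq_abs,
        sub_sub_cancel, abs_of_pos (by positivity)]
      linarith
    · gcongr
      linarith
  have hpow : ∀ n : ℕ, 0 < q ^ n * s ∧ q ^ n * s ≤ s := fun n =>
    ⟨by positivity, mul_le_of_le_one_left hs.le (pow_le_one₀ hq0.le hq1.le)⟩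
  have hchain : ∀ n : ℕ, |u (y + s • e) - u (y + (q ^ n * s) • e)| ≤
      L * ∑ k ∈ Finset.range n, (q ^ γ) ^ k := by
    intro n
    induction n with
    | zero => simp
    | succ n ih =>
      have h := hstep (q ^ n * s) (hpow n).1 (hpow n).2
      have h2 : (q ^ n * s) ^ γ ≤ (q ^ γ) ^ n := by
        rw [Real.mul_rpow (by positivity) hs.le, ← Real.rpow_natCast, ← Real.rpow_natCast,
          ← Real.rpow_mul hq0.le, ← Real.rpow_mul hq0.le, mul_comm (n : ℝ)]
        exact mul_le_of_le_one_right (by positivity) (Real.rpow_le_one hs.le hs1 hγ.le)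
      rw [Finset.sum_range_succ, mul_add, pow_succ', mul_assoc q]
      exact (abs_sub_le _ _ _).trans
        (add_le_add ih (h.trans (mul_le_mul_of_nonneg_left h2 hL)))
  -- The chain only converges to `y`. One last jump inside a ball around `y` costs at most `L`,
  -- however small its radius; this is the `+ 1` in the constant.
  obtain ⟨r, hr, hr1, hball⟩ := hΩ.exists_ball_eventually_subset hy
  obtain ⟨n, hn⟩ := exists_pow_lt_of_lt_one (half_pos hr) hq1
  have hd : dist (y + (q ^ n * s) • e) y ≤ r / 2 := by
    rw [dist_eq_norm, add_sub_cancel_left, norm_smul, he, mul_one, Real.norm_eq_abs,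
      abs_of_pos (hpow n).1]
    exact (mul_le_of_le_one_right (by positivity) hs1).trans hn.le
  have hlast := hu.abs_sub_le hγ.le hL hr hr1 (hball _ hd)
    (hball y (by rw [dist_self]; positivity)) hd
  have hsum : ∑ k ∈ Finset.range n, (q ^ γ) ^ k ≤ 1 / (1 - q ^ γ) := by
    rw [one_div, ← tsum_geometric_of_lt_one hqγ0.le hqγ1]
    exact (summable_geometric_of_lt_one hqγ0.le hqγ1).sum_le_tsum _ fun k _ => by positivity
  have := (hchain n).trans (mul_le_mul_of_nonneg_left hsum hL)
  linarith [abs_sub_le (u (y + s • e)) (u (y + (q ^ n * s) • e)) (u y)]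

/-- A domain with `C^{1,1}` boundary satisfies a uniform interior cone condition near each of its
boundary points. -/
theorem HasC11Boundary.exists_cone {N : ℕ} {Ω : Set (EuclideanSpace ℝ (Fin N))}
    (h : HasC11Boundary Ω) {x₀ : EuclideanSpace ℝ (Fin N)} (hx₀ : x₀ ∈ frontier Ω) :
    ∃ e : EuclideanSpace ℝ (Fin N), ‖e‖ = 1 ∧ ∃ s c ε : ℝ, 0 < s ∧ s ≤ 1 ∧ 0 < c ∧ c ≤ 1 ∧
      0 < ε ∧ ∀ y ∈ ball x₀ ε ∩ Ω, ∀ t, 0 < t → t ≤ s → ball (y + t • e) (c * t) ⊆ Ω := by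
  obtain ⟨r, hr, e, he, g, hg, -, hΩ⟩ := h x₀ hx₀
  set P : EuclideanSpace ℝ (Fin N) → EuclideanSpace ℝ (Fin N) := fun y => y - inner ℝ e y • e
    with hP
  have hPsub : ∀ y w, P y - P w = P (y - w) := by
    intro y w
    simp only [hP, inner_sub_right, sub_smul]
    abel
  have hPnorm : ∀ v, ‖P v‖ ≤ 2 * ‖v‖ := by
    intro v
    have h1 : ‖inner ℝ e v • e‖ ≤ ‖v‖ := by
      rw [norm_smul, he, mul_one]
      simpa [he] using norm_inner_le_norm (𝕜 := ℝ) e v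
    calc ‖P v‖ ≤ ‖v‖ + ‖inner ℝ e v • e‖ := norm_sub_le _ _
      _ ≤ 2 * ‖v‖ := by linarith
  have hee : inner ℝ e e = (1 : ℝ) := by rw [real_inner_self_eq_norm_sq, he, one_pow]
  obtain ⟨Λ, T, hT, hΛ⟩ := (hg.contDiffAt (x := P x₀)).exists_lipschitzOnWith
  obtain ⟨R, hR, hRT⟩ := Metric.mem_nhds_iff.1 hT
  -- All points considered stay within `3 * ρ` of `x₀`, and their projections within `6 * ρ` of that
  -- of `x₀`, so both the graph description and the Lipschitz bound on `g` apply.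
  set ρ := min 1 (min r R / 8) with hρ
  have hρ0 : 0 < ρ := by positivity
  have hρr : ρ ≤ r / 8 := (min_le_right _ _).trans (by gcongr; exact min_le_left _ _)
  have hρR : ρ ≤ R / 8 := (min_le_right _ _).trans (by gcongr; exact min_le_right _ _)
  have hden : (0 : ℝ) < 1 + 2 * Λ := by positivity
  refine ⟨e, he, ρ, 1 / (1 + 2 * Λ), ρ, hρ0, min_le_left _ _, by positivity, ?_, hρ0, ?_⟩
  · rw [div_le_one hden]
    linarith [Λ.coe_nonneg]
  set c : ℝ := 1 / (1 + 2 * Λ) with hc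
  have hc1 : c ≤ 1 := by
    rw [hc, div_le_one hden]
    linarith [Λ.coe_nonneg]
  -- A displacement shorter than `c * t` lowers the height by less than `c * t` and raises the graph
  -- by at most `2 * Λ * c * t`; together this is less than the height `t` gained along `e`.
  have hcΛ : c + 2 * Λ * c = 1 := by rw [hc]; field_simp
  rintro y ⟨hy, hyΩ⟩ t ht htρ w hw
  have hct : c * t ≤ t := mul_le_of_le_one_left ht.le hc1
  rw [mem_ball, dist_eq_norm] at hy hw
  set v := w - (y + t • e) with hv
  have hw' : w = y + t • e + v := by rw [hv]; abel
  have hte : ‖t • e‖ = t := by rw [norm_smul, he, mul_one, Real.norm_of_nonneg ht.le]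
  have hwx : ‖w - x₀‖ < 3 * ρ := by
    have : w - x₀ = (y - x₀) + t • e + v := by rw [hw']; abel
    rw [this]
    linarith [norm_add₃_le (a := y - x₀) (b := t • e) (c := v)]
  rw [hΩ w (by rw [mem_ball, dist_eq_norm]; linarith)]
  have hyg := (hΩ y (by rw [mem_ball, dist_eq_norm]; linarith)).1 hyΩ
  have hPwy : P w - P y = P v := by
    rw [hPsub, hw']
    simp only [hP, inner_sub_right, inner_add_right, inner_smul_right, hee]
    module
  have hlip : |g (P w) - g (P y)| ≤ Λ * ‖P v‖ := by
    have := hΛ.dist_le_mul (P w) (hRT ?_) (P y) (hRT ?_)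
    · rwa [Real.dist_eq, dist_eq_norm, hPwy] at this
    · rw [mem_ball, dist_eq_norm, hPsub]
      linarith [hPnorm (w - x₀)]
    · rw [mem_ball, dist_eq_norm, hPsub]
      linarith [hPnorm (y - x₀)]
  have hev : -‖v‖ ≤ inner ℝ e v := by
    have := (abs_le.1 (abs_real_inner_le_norm e v)).1
    rwa [he, one_mul] at this
  have hew : inner ℝ e w = inner ℝ e y + t + inner ℝ e v := by
    rw [hw', inner_add_right, inner_add_right, inner_smul_right, hee, mul_one]
  have h1 : Λ * ‖P v‖ ≤ Λ * (2 * ‖v‖) := by gcongr; exact hPnorm v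
  have h2 : Λ * (2 * ‖v‖) ≤ Λ * (2 * (c * t)) := by gcongr
  have h3 : c * t + Λ * (2 * (c * t)) = t := by linear_combination t * hcΛ
  change g (P w) < _
  rw [hew]
  change g (P y) < _ at hyg
  linarith [(abs_le.1 hlip).2]

/-- Compactness of the closure makes the local bounds uniform. Near a boundary point, the cones
carry all nearby points of `Ω` into a small ball inside `Ω`, where an interior bound is available.
-/
theorem exists_bound_of_interiorHolder {N : ℕ} {Ω : Set (EuclideanSpace ℝ (Fin N))}
    (hΩ : IsOpen Ω) (hc : IsConnected Ω) (hb : Bornology.IsBounded Ω) (hC : HasC11Boundary Ω)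
    {γ : ℝ} (hγ : 0 < γ) :
    ∃ K : ℝ, 0 ≤ K ∧ ∀ (u : EuclideanSpace ℝ (Fin N) → ℝ) (L : ℝ), 0 ≤ L →
      InteriorHolder Ω γ L u → ∀ x ∈ Ω, ∀ y ∈ Ω, |u x - u y| ≤ K * L := by
  obtain ⟨a, ha⟩ := hc.nonempty
  have hloc : ∀ x ∈ Ω, ∃ ε > 0, ∃ K : ℝ, ∀ (u : EuclideanSpace ℝ (Fin N) → ℝ) (L : ℝ), 0 ≤ L →
      InteriorHolder Ω γ L u → ∀ y ∈ ball x ε, |u y - u a| ≤ K * L := by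
    intro x hx
    obtain ⟨r, hr, hr1, h⟩ := hΩ.exists_ball_eventually_subset hx
    obtain ⟨K, hK⟩ := exists_bound_of_interiorHolder_of_mem hΩ hc.isPreconnected hγ.le hx ha
    refine ⟨r / 2, half_pos hr, 1 + K, fun u L hL hu y hy => ?_⟩
    have h1 := hu.abs_sub_le hγ.le hL hr hr1 (h y (mem_ball.1 hy).le)
      (h x (by rw [dist_self]; positivity)) (mem_ball.1 hy).le
    linarith [abs_sub_le (u y) (u x) (u a), hK u L hL hu]
  have key : ∃ K : ℝ, ∀ (u : EuclideanSpace ℝ (Fin N) → ℝ) (L : ℝ), 0 ≤ L →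
      InteriorHolder Ω γ L u → ∀ y ∈ closure Ω ∩ Ω, |u y - u a| ≤ K * L := by
    refine hb.isCompact_closure.induction_on (p := fun S => ∃ K : ℝ,
      ∀ (u : EuclideanSpace ℝ (Fin N) → ℝ) (L : ℝ), 0 ≤ L →
      InteriorHolder Ω γ L u → ∀ y ∈ S ∩ Ω, |u y - u a| ≤ K * L) ?_ ?_ ?_ ?_
    · exact ⟨0, by simp⟩
    · rintro S T hST ⟨K, hK⟩
      exact ⟨K, fun u L hL hu y hy => hK u L hL hu y ⟨hST hy.1, hy.2⟩⟩
    · rintro S T ⟨K, hK⟩ ⟨K', hK'⟩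
      refine ⟨max K K', fun u L hL hu y hy => ?_⟩
      rcases hy with ⟨hy | hy, hyΩ⟩
      · exact (hK u L hL hu y ⟨hy, hyΩ⟩).trans (by gcongr; exact le_max_left _ _)
      · exact (hK' u L hL hu y ⟨hy, hyΩ⟩).trans (by gcongr; exact le_max_right _ _)
    · intro x hx
      by_cases hxΩ : x ∈ Ω
      · obtain ⟨ε, hε, K, hK⟩ := hloc x hxΩ
        exact ⟨ball x ε, mem_nhdsWithin_of_mem_nhds (ball_mem_nhds x hε), K,
          fun u L hL hu y hy => hK u L hL hu y hy.1⟩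
      · have hxf : x ∈ frontier Ω := by
          rw [hΩ.frontier_eq]
          exact ⟨hx, hxΩ⟩
        obtain ⟨e, he, s, c, ε, hs, hs1, hc0, hc1, hε, hcone⟩ := hC.exists_cone hxf
        obtain ⟨K, hK⟩ := exists_bound_of_cone hc0 hc1 hs hs1 hγ
        have hxe : x + s • e ∈ Ω := by
          obtain ⟨y, hyΩ, hy⟩ := Metric.mem_closure_iff.1 hx (min ε (c * s)) (by positivity)
          refine hcone y ⟨?_, hyΩ⟩ s hs le_rfl ?_
          · rw [mem_ball, dist_comm]
            exact hy.trans_le (min_le_left _ _)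
          · rw [mem_ball, dist_add_right]
            exact hy.trans_le (min_le_right _ _)
        obtain ⟨ε', hε', K', hK'⟩ := hloc _ hxe
        refine ⟨ball x (min ε ε'), mem_nhdsWithin_of_mem_nhds (ball_mem_nhds x (by positivity)),
          K + K', fun u L hL hu y hy => ?_⟩
        have h1 := hK hΩ hy.2 he
          (hcone y ⟨ball_subset_ball (min_le_left _ _) hy.1, hy.2⟩) u L hL hu
        have h2 := hK' u L hL hu (y + s • e) (by
          rw [mem_ball, dist_add_right]
          exact (mem_ball.1 hy.1).trans_le (min_le_right _ _))
        rw [abs_sub_comm] at h1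
        linarith [abs_sub_le (u y) (u (y + s • e)) (u a)]
  obtain ⟨K, hK⟩ := key
  refine ⟨2 * |K|, by positivity, fun u L hL hu x hx y hy => ?_⟩
  have h1 := hK u L hL hu x ⟨subset_closure hx, hx⟩
  have h2 := hK u L hL hu y ⟨subset_closure hy, hy⟩
  rw [abs_sub_comm] at h2
  have h3 : K * L ≤ |K| * L := by gcongr; exact le_abs_self K
  linarith [abs_sub_le (u x) (u a) (u y)]

/-! ### Estimates of the nonlocal operator -/

/-- No integrability of `f` is required: a non-integrable `f` has integral 0 by convention, and the
bound is nonnegative. -/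
theorem setIntegral_le_of_le_add_mul {X : Type*} [MeasurableSpace X] {μ : Measure X} {S : Set X}
    (hS : MeasurableSet S) {f v w : X → ℝ} {a b B C : ℝ} (ha : 0 ≤ a) (hb : 0 ≤ b) (hB : 0 ≤ B)
    (hC : 0 ≤ C) (hv : Measurable v)
    (hvB : ∫⁻ z in S, ENNReal.ofReal (v z) ∂μ ≤ ENNReal.ofReal B)
    (hwC : ∫⁻ z in S, ENNReal.ofReal (w z) ∂μ ≤ ENNReal.ofReal C)
    (hf : ∀ᵐ z ∂μ, z ∈ S → f z ≤ a * v z + b * w z) :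
    ∫ z in S, f z ∂μ ≤ a * B + b * C := by
  have hnn : 0 ≤ a * B + b * C := by positivity
  by_cases hint : Integrable f (μ.restrict S)
  swap
  · rwa [integral_undef hint]
  have hle : ∫⁻ z in S, ENNReal.ofReal (f z) ∂μ ≤ ENNReal.ofReal (a * B + b * C) := by
    calc ∫⁻ z in S, ENNReal.ofReal (f z) ∂μ
        ≤ ∫⁻ z in S, (ENNReal.ofReal a * ENNReal.ofReal (v z) +
            ENNReal.ofReal b * ENNReal.ofReal (w z)) ∂μ := by
          refine lintegral_mono_ae ?_
          filter_upwards [(ae_restrict_iff' hS).2 hf] with z hz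
          rw [← ENNReal.ofReal_mul ha, ← ENNReal.ofReal_mul hb]
          exact (ENNReal.ofReal_le_ofReal hz).trans ENNReal.ofReal_add_le
      _ = ENNReal.ofReal a * ∫⁻ z in S, ENNReal.ofReal (v z) ∂μ +
            ENNReal.ofReal b * ∫⁻ z in S, ENNReal.ofReal (w z) ∂μ := by
          rw [lintegral_add_left (hv.ennreal_ofReal.const_mul _),
            lintegral_const_mul' _ _ ENNReal.ofReal_ne_top,
            lintegral_const_mul' _ _ ENNReal.ofReal_ne_top]
      _ ≤ ENNReal.ofReal a * ENNReal.ofReal B + ENNReal.ofReal b * ENNReal.ofReal C := by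
          gcongr
      _ = ENNReal.ofReal (a * B + b * C) := by
          rw [← ENNReal.ofReal_mul ha, ← ENNReal.ofReal_mul hb,
            ENNReal.ofReal_add (by positivity) (by positivity)]
  rw [integral_eq_lintegral_pos_part_sub_lintegral_neg_part hint]
  refine (sub_le_self _ ENNReal.toReal_nonneg).trans ?_
  exact ENNReal.toReal_le_of_le_ofReal hnn hle

theorem hasGradientAt_inner_add_sq {E : Type*} [NormedAddCommGroup E] [InnerProductSpace ℝ E]
    [CompleteSpace E] (x p : E) (c : ℝ) :
    HasGradientAt (fun w => inner ℝ p (w - x) + c * ‖w - x‖ ^ 2) p x := by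
  rw [hasGradientAt_iff_hasFDerivAt]
  have h1 : HasFDerivAt (fun w => inner ℝ p (w - x)) (innerSL ℝ p) x :=
    (innerSL ℝ p).hasFDerivAt.comp x ((hasFDerivAt_id x).sub_const x)
  have h2 := (((hasFDerivAt_id x).sub_const x).norm_sq).const_mul c
  refine (h1.add h2).congr_fderiv ?_
  ext v
  simp

theorem contDiff_inner_add_sq {E : Type*} [NormedAddCommGroup E] [InnerProductSpace ℝ E]
    (x p : E) (c : ℝ) (n : WithTop ℕ∞) :
    ContDiff ℝ n (fun w => inner ℝ p (w - x) + c * ‖w - x‖ ^ 2) := by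
  have h : ContDiff ℝ n (fun w : E => w - x) := contDiff_id.sub contDiff_const
  exact (contDiff_const.inner ℝ h).add (contDiff_const.mul (h.norm_sq ℝ))

/-- An empty frontier has distance 0 by convention, but then the left side is `0 ^ (-θ)`, which is 0
or 1. -/
theorem infDist_frontier_rpow_le {E : Type*} [PseudoMetricSpace E] {Ω : Set E} (hΩ : IsOpen Ω)
    {x : E} {δ θ : ℝ} (hδ : 0 < δ) (hδ1 : δ ≤ 1) (hθ : 0 ≤ θ) (hx : ball x δ ⊆ Ω) :
    infDist x (frontier Ω) ^ (-θ) ≤ δ ^ (-θ) := by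
  rcases (frontier Ω).eq_empty_or_nonempty with h | h
  · rw [h, infDist_empty]
    refine le_trans ?_ (Real.one_le_rpow_of_pos_of_le_one_of_nonpos hδ hδ1 (by linarith))
    rcases hθ.eq_or_lt with rfl | h0
    · simp
    · rw [Real.zero_rpow (by linarith)]
      exact zero_le_one
  · refine Real.rpow_le_rpow_of_nonpos hδ ((le_infDist h).2 fun y hy => ?_) (by linarith)
    by_contra! hlt
    rw [hΩ.frontier_eq] at hy
    exact hy.2 (hx (by rwa [mem_ball, dist_comm]))

/-- The contribution to the operator of a small ball, for a quadratic test function. -/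
theorem exists_bound_nonlocalOp_ball {N : ℕ} {σ : ℝ} (hσ : σ ∈ Ioo (0 : ℝ) 2)
    {ν : EuclideanSpace ℝ (Fin N) → Measure (EuclideanSpace ℝ (Fin N))} (hM2 : CondM2 σ ν)
    {R : ℝ} (hR : 0 < R) :
    ∃ C : ℝ, 0 ≤ C ∧ ∀ x ∈ closedBall 0 R, ∀ δ ∈ Ioo (0 : ℝ) 1, ∀ p,
      nonlocalOp σ (ν x) (ball 0 δ)
        (fun w => inner ℝ p (w - x) + 2 * ‖p‖ / δ * ‖w - x‖ ^ 2) x p ≤ C * ‖p‖ * δ ^ (1 - σ) := by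
  by_cases h1 : 1 ≤ σ
  -- Since `δ < 1`, the compensator cancels the linear part exactly and only the quadratic part
  -- remains.
  · obtain ⟨C, hC, h⟩ := hM2 R hR 2 ⟨hσ.2, le_rfl⟩
    refine ⟨2 * C, by positivity, fun x hx δ hδ p => ?_⟩
    have h0 := hδ.1
    have key := setIntegral_le_of_le_add_mul (μ := ν x) (S := ball 0 δ) measurableSet_ball
      (f := fun z => inner ℝ p (x + z - x) + 2 * ‖p‖ / δ * ‖x + z - x‖ ^ 2 -
        (inner ℝ p (x - x) + 2 * ‖p‖ / δ * ‖x - x‖ ^ 2) -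
        if 1 ≤ σ then (ball (0 : EuclideanSpace ℝ (Fin N)) 1).indicator (fun w => inner ℝ p w) z
        else 0)
      (v := fun z => ‖z‖ ^ (2 : ℝ)) (w := fun z => ‖z‖ ^ (2 : ℝ)) (a := 2 * ‖p‖ / δ) (b := 0)
      (B := C * δ ^ (2 - σ)) (C := C * δ ^ (2 - σ))
      (by positivity) le_rfl (by positivity) (by positivity)
      (by fun_prop) (h δ hδ x hx) (h δ hδ x hx) (Filter.Eventually.of_forall fun z hz => ?_)
    · refine key.trans_eq ?_
      have : δ ^ (2 - σ) = δ ^ (1 - σ) * δ := by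
        rw [← Real.rpow_add_one h0.ne']
        ring_nf
      rw [this]
      field_simp
      ring
    · have hz1 : z ∈ ball (0 : EuclideanSpace ℝ (Fin N)) 1 := ball_subset_ball hδ.2.le hz
      simp [h1, indicator_of_mem hz1]
  · push Not at h1
    -- There is no compensator, but first moments are finite; on the ball the quadratic part is at
    -- most `2 * ‖p‖ * ‖z‖`.
    obtain ⟨C, hC, h⟩ := hM2 R hR 1 ⟨h1, one_le_two⟩
    refine ⟨3 * C, by positivity, fun x hx δ hδ p => ?_⟩
    have h0 := hδ.1
    have key := setIntegral_le_of_le_add_mul (μ := ν x) (S := ball 0 δ) measurableSet_ball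
      (f := fun z => inner ℝ p (x + z - x) + 2 * ‖p‖ / δ * ‖x + z - x‖ ^ 2 -
        (inner ℝ p (x - x) + 2 * ‖p‖ / δ * ‖x - x‖ ^ 2) -
        if 1 ≤ σ then (ball (0 : EuclideanSpace ℝ (Fin N)) 1).indicator (fun w => inner ℝ p w) z
        else 0)
      (v := fun z => ‖z‖ ^ (1 : ℝ)) (w := fun z => ‖z‖ ^ (1 : ℝ)) (a := 3 * ‖p‖) (b := 0)
      (B := C * δ ^ (1 - σ)) (C := C * δ ^ (1 - σ))
      (by positivity) le_rfl (by positivity) (by positivity)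
      (by fun_prop) (h δ hδ x hx) (h δ hδ x hx) (Filter.Eventually.of_forall fun z hz => ?_)
    · refine key.trans_eq ?_
      ring
    · rw [mem_ball_zero_iff] at hz
      have h2 : inner ℝ p z ≤ ‖p‖ * ‖z‖ := real_inner_le_norm p z
      have h3 : 2 * ‖p‖ / δ * ‖z‖ ^ 2 ≤ 2 * ‖p‖ * ‖z‖ := by
        rw [div_mul_eq_mul_div, div_le_iff₀ h0, sq, ← mul_assoc]
        gcongr
      simp only [add_sub_cancel_left, sub_self, inner_zero_right, norm_zero, not_le.2 h1, if_false,
        Real.rpow_one]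
      linarith

/-- The contribution to a censored operator of the complement of a small ball. -/
theorem exists_bound_nonlocalOp_compl_ball {N : ℕ} {Ω : Set (EuclideanSpace ℝ (Fin N))}
    {σ α : ℝ} (hσ : σ ∈ Ioo (0 : ℝ) 2) (hα0 : 0 ≤ α) (hα1 : α ≤ 1) (hασ : α < σ)
    {ν : EuclideanSpace ℝ (Fin N) → Measure (EuclideanSpace ℝ (Fin N))} (hM1 : CondM1 σ ν)
    (hcens : IsCensored Ω ν) {R : ℝ} (hR : 0 < R) :
    ∃ C₀ C₁ : ℝ, 0 ≤ C₀ ∧ 0 ≤ C₁ ∧ ∀ x ∈ closedBall 0 R, x ∈ Ω → ∀ δ > 0, ∀ p,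
      ∀ (u : EuclideanSpace ℝ (Fin N) → ℝ) (M : ℝ), 0 ≤ M → (∀ w ∈ Ω, u w - u x ≤ M) →
      nonlocalOp σ (ν x) (ball 0 δ)ᶜ u x p ≤ M * (C₀ * δ ^ (-σ)) + ‖p‖ * (C₁ * δ ^ (α - σ)) := by
  -- Exponent 0 bounds the mass of long jumps, and `α` bounds the compensator. Taking `α < σ` avoids
  -- the logarithm in `hFun`.
  obtain ⟨C₀, hC₀, h₀⟩ := hM1 R hR 0 ⟨le_rfl, zero_le_two⟩
  obtain ⟨C₁, hC₁, h₁⟩ := hM1 R hR α ⟨hα0, by linarith⟩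
  refine ⟨C₀, C₁, hC₀.le, hC₁.le, fun x hx hxΩ δ hδ p u M hM hu => ?_⟩
  have e₀ := h₀ δ hδ x hx
  have e₁ := h₁ δ hδ x hx
  rw [hFun, if_pos hσ.1, zero_sub] at e₀
  rw [hFun, if_pos hασ] at e₁
  refine setIntegral_le_of_le_add_mul measurableSet_ball.compl hM (norm_nonneg p) (by positivity)
    (by positivity) (by fun_prop) e₀ e₁ ?_
  have hae : ∀ᵐ z ∂(ν x), x + z ∈ Ω := by
    rw [ae_iff]
    exact hcens x hxΩ
  filter_upwards [hae] with z hz _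
  have hw0 : min 1 (‖z‖ ^ (0 : ℝ)) = 1 := by simp
  have hw1 : 0 ≤ min 1 (‖z‖ ^ α) := by positivity
  have hin : -(‖p‖ * min 1 (‖z‖ ^ α)) ≤
      if 1 ≤ σ then (ball (0 : EuclideanSpace ℝ (Fin N)) 1).indicator (fun w => inner ℝ p w) z
        else 0 := by
    have hneg : -(‖p‖ * min 1 (‖z‖ ^ α)) ≤ 0 := by
      have := mul_nonneg (norm_nonneg p) hw1
      linarith
    split_ifs
    · by_cases hz1 : z ∈ ball (0 : EuclideanSpace ℝ (Fin N)) 1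
      · rw [indicator_of_mem hz1]
        rw [mem_ball_zero_iff] at hz1
        have hle : ‖z‖ ≤ min 1 (‖z‖ ^ α) := by
          refine le_min hz1.le ?_
          exact Real.self_le_rpow_of_le_one (norm_nonneg z) hz1.le hα1
        have := (abs_le.1 (abs_real_inner_le_norm p z)).1
        have := mul_le_mul_of_nonneg_left hle (norm_nonneg p)
        linarith
      · rw [indicator_of_notMem hz1]
        exact hneg
    · exact hneg
  rw [hw0]
  linarith [hu _ hz]

/-- The viscosity inequality for a subsolution that is touched from above by a paraboloid. -/
theorem exists_gradient_inequality {N : ℕ} {Ω : Set (EuclideanSpace ℝ (Fin N))}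
    (hΩ : IsOpen Ω) (hb : Bornology.IsBounded Ω) {A b₀ σ m θ α : ℝ} (hA : 0 ≤ A)
    (hσ : σ ∈ Ioo (0 : ℝ) 2) (hθ : 0 ≤ θ) (hα0 : 0 ≤ α) (hα1 : α ≤ 1) (hασ : α < σ)
    {ν : EuclideanSpace ℝ (Fin N) → Measure (EuclideanSpace ℝ (Fin N))} (hM1 : CondM1 σ ν)
    (hM2 : CondM2 σ ν) (hcens : IsCensored Ω ν) :
    ∃ C₀ C₁ : ℝ, 0 ≤ C₀ ∧ 0 ≤ C₁ ∧ ∀ u : EuclideanSpace ℝ (Fin N) → ℝ,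
      IsViscositySubsolution Ω σ m θ A b₀ ν u → ∀ x ∈ Ω, ∀ M : ℝ, 0 ≤ M →
      (∀ w ∈ Ω, u w - u x ≤ M) → ∀ δ ∈ Ioo (0 : ℝ) 1, ball x δ ⊆ Ω → ∀ p,
      (∀ w ∈ ball x δ, u w - u x ≤ inner ℝ p (w - x) + 2 * ‖p‖ / δ * ‖w - x‖ ^ 2) →
      b₀ * ‖p‖ ^ m ≤ 2 * A * δ ^ (-θ) + C₀ * M * δ ^ (-σ) + C₁ * ‖p‖ * δ ^ (α - σ) := by
  obtain ⟨R, hR, hΩR⟩ := hb.subset_closedBall_lt 0 0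
  obtain ⟨C, hC, h2⟩ := exists_bound_nonlocalOp_ball hσ hM2 hR
  obtain ⟨C₀, C₁, hC₀, hC₁, h1⟩ :=
    exists_bound_nonlocalOp_compl_ball hσ hα0 hα1 hασ hM1 hcens hR
  refine ⟨C₀, C + C₁, hC₀, by positivity, fun u hu x hx M hM huM δ hδ hball p hp => ?_⟩
  have hgrad := (hasGradientAt_inner_add_sq x p (2 * ‖p‖ / δ)).gradient
  have hvis := hu.2 x hx δ hδ.1 hball _ (contDiff_inner_add_sq x p (2 * ‖p‖ / δ) 2) (by
    intro w hw
    have := hp w hw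
    simp only [mem_ofPred_eq, sub_self, inner_zero_right, norm_zero]
    linarith)
  rw [hgrad] at hvis
  have hI1 := h2 x (hΩR hx) δ hδ p
  have hI2 := h1 x (hΩR hx) hx δ hδ.1 p u M hM huM
  have hd := infDist_frontier_rpow_le hΩ hδ.1 hδ.2.le hθ hball
  have hone : 1 ≤ δ ^ (-θ) :=
    Real.one_le_rpow_of_pos_of_le_one_of_nonpos hδ.1 hδ.2.le (by linarith)
  have hA2 : A * (infDist x (frontier Ω) ^ (-θ) + 1) ≤ A * (2 * δ ^ (-θ)) := by
    gcongr
    linarith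
  have hpow : C * ‖p‖ * δ ^ (1 - σ) ≤ C * ‖p‖ * δ ^ (α - σ) := by
    gcongr C * ‖p‖ * ?_
    exact Real.rpow_le_rpow_of_exponent_ge hδ.1 hδ.2.le (by linarith)
  linarith

/-! ### The barrier and the touching argument -/

/-- The profile `ρ ↦ (rρ / (r - ρ))^γ` is semiconcave along Euclidean balls. -/
theorem rpow_profile_le {γ r ρ ρ' δ b s : ℝ} (hγ0 : 0 < γ) (hγ1 : γ < 1) (hρ : 0 < ρ)
    (hρr : ρ < r) (hδ : 0 < δ) (hδρ : δ ≤ ρ) (hδr : 3 * δ ≤ r - ρ) (hb : |b| ≤ s) (hs : s ≤ δ)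
    (hρ'0 : 0 ≤ ρ') (hρ' : ρ' ≤ ρ + (b + s ^ 2 / (2 * ρ))) :
    (r * ρ' / (r - ρ')) ^ γ ≤ (r * ρ / (r - ρ)) ^ γ +
      γ * (r * ρ / (r - ρ)) ^ (γ - 1) * (r / (r - ρ)) ^ 2 * (b + 2 * s ^ 2 / δ) := by
  have hs0 : 0 ≤ s := (abs_nonneg b).trans hb
  have hr : 0 < r := hρ.trans hρr
  set D := r - ρ with hD
  have hD0 : 0 < D := by linarith
  set h := b + s ^ 2 / (2 * ρ) with hh
  have hsρ0 : 0 ≤ s ^ 2 / (2 * ρ) := by positivity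
  have hsρ : s ^ 2 / (2 * ρ) ≤ s / 2 := by
    rw [div_le_div_iff₀ (by positivity) two_pos]
    nlinarith
  have hsδ : s ^ 2 / (2 * ρ) ≤ s ^ 2 / δ / 2 := by
    rw [div_div, mul_comm δ]
    gcongr
  have hhs : |h| ≤ 3 / 2 * s := by
    rw [abs_le] at hb ⊢
    constructor <;> linarith
  have hhD : h ≤ D / 2 := by linarith [(abs_le.1 hhs).2]
  have hDh : 0 < D - h := by linarith
  set T := r * ρ / D with hT
  have hT0 : 0 < T := by positivity
  set T₁ := r * (ρ + h) / (D - h) with hT₁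
  have hρh : 0 ≤ ρ + h := hρ'0.trans hρ'
  have hT₁0 : 0 ≤ T₁ := by positivity
  have hmono : r * ρ' / (r - ρ') ≤ T₁ := by
    exact div_le_div₀ (by positivity) (by gcongr) hDh (by linarith)
  -- From `D ≥ 3 * δ` and `h ≤ 3 / 2 * δ` follows `D - h ≥ 3 / 2 * δ`. The curvature of the norm
  -- gives `1 / 2` and that of the fraction `3 / 2`, whence the factor 2.
  have hquad : h + h ^ 2 / (D - h) ≤ b + 2 * s ^ 2 / δ := by
    have h1 : h ^ 2 ≤ 9 / 4 * s ^ 2 := by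
      have := sq_le_sq' (by linarith [(abs_le.1 hhs).1]) (abs_le.1 hhs).2
      linarith
    have h2 : h ^ 2 / (D - h) ≤ 3 / 2 * (s ^ 2 / δ) := by
      calc h ^ 2 / (D - h) ≤ (9 / 4 * s ^ 2) / (3 / 2 * δ) := by
            gcongr
            linarith
        _ = 3 / 2 * (s ^ 2 / δ) := by field_simp; ring
    rw [mul_div_assoc]
    linarith
  -- An exact expansion of `t ↦ r * t / (r - t)` at `ρ`; the power `γ` is then handled by concavity,
  -- through Bernoulli's inequality.
  have hdiff : T₁ - T = (r / D) ^ 2 * (h + h ^ 2 / (D - h)) := by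
    rw [hT₁, hT]
    field_simp
    rw [hD]
    ring
  have hbern : (1 + (T₁ - T) / T) ^ γ ≤ 1 + γ * ((T₁ - T) / T) := by
    refine rpow_one_add_le_one_add_mul_self ?_ hγ0.le hγ1.le
    rw [le_div_iff₀ hT0]
    linarith
  have hT₁T : T₁ = T * (1 + (T₁ - T) / T) := by field_simp; ring
  calc (r * ρ' / (r - ρ')) ^ γ ≤ T₁ ^ γ := by
        refine Real.rpow_le_rpow ?_ hmono hγ0.le
        have : ρ' ≤ r := by linarith
        exact div_nonneg (by positivity) (by linarith)
    _ = T ^ γ * (1 + (T₁ - T) / T) ^ γ := by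
        nth_rewrite 1 [hT₁T]
        refine Real.mul_rpow hT0.le ?_
        have : 1 + (T₁ - T) / T = T₁ / T := by field_simp; ring
        rw [this]
        positivity
    _ ≤ T ^ γ * (1 + γ * ((T₁ - T) / T)) := by gcongr
    _ = T ^ γ + γ * T ^ (γ - 1) * (r / D) ^ 2 * (h + h ^ 2 / (D - h)) := by
        rw [Real.rpow_sub_one hT0.ne', hdiff]
        field_simp
    _ ≤ _ := by gcongr

/-- With `T = r * ρ / (r - ρ)` and `δ` the minimum, `T ≥ δ` and `γ > 0` give `(T / δ) ^ (γ - 1) ≥ δ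
/ T`, so `ρ * (r - ρ) ≤ 3 * δ * r` suffices. This bounds the barrier's slope from below. -/
theorem rpow_le_three_mul_profile_deriv {γ r ρ : ℝ} (hγ0 : 0 < γ) (hρ : 0 < ρ) (hρr : ρ < r) :
    (min ρ ((r - ρ) / 3)) ^ (γ - 1) ≤
      3 * ((r * ρ / (r - ρ)) ^ (γ - 1) * (r / (r - ρ)) ^ 2) := by
  have hr : 0 < r := hρ.trans hρr
  set D := r - ρ with hD
  have hD0 : 0 < D := by linarith
  set δ := min ρ (D / 3) with hδ
  have hδ0 : 0 < δ := by positivity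
  have hδρ : δ ≤ ρ := min_le_left _ _
  set T := r * ρ / D with hT
  have hT0 : 0 < T := by positivity
  have hδT : 1 ≤ T / δ := by
    rw [one_le_div hδ0, hT, le_div_iff₀ hD0]
    nlinarith
  have h1 : (T / δ) ^ (-1 : ℝ) ≤ (T / δ) ^ (γ - 1) :=
    Real.rpow_le_rpow_of_exponent_le hδT (by linarith)
  have h2 : ρ * D ≤ 3 * δ * r := by
    rcases min_choice ρ (D / 3) with h | h
    · rw [hδ, h]; nlinarith
    · rw [hδ, h]; nlinarith
  have h3 : 1 ≤ 3 * ((T / δ) ^ (-1 : ℝ) * (r / D) ^ 2) := by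
    rw [Real.rpow_neg_one, hT]
    have : 3 * ((r * ρ / D / δ)⁻¹ * (r / D) ^ 2) = 3 * δ * r / (ρ * D) := by field_simp
    rwa [this, one_le_div (by positivity)]
  have h4 : T ^ (γ - 1) = δ ^ (γ - 1) * (T / δ) ^ (γ - 1) := by
    rw [← Real.mul_rpow hδ0.le (by positivity), mul_div_cancel₀ _ hδ0.ne']
  calc δ ^ (γ - 1) ≤ δ ^ (γ - 1) * (3 * ((T / δ) ^ (-1 : ℝ) * (r / D) ^ 2)) :=
        le_mul_of_one_le_right (by positivity) h3
    _ ≤ δ ^ (γ - 1) * (3 * ((T / δ) ^ (γ - 1) * (r / D) ^ 2)) := by gcongr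
    _ = _ := by rw [h4]; ring

theorem norm_add_le_of_inner {E : Type*} [NormedAddCommGroup E] [InnerProductSpace ℝ E] {v : E}
    (hv : v ≠ 0) (z : E) :
    ‖v + z‖ ≤ ‖v‖ + (inner ℝ (‖v‖⁻¹ • v) z + ‖z‖ ^ 2 / (2 * ‖v‖)) := by
  have hv0 : 0 < ‖v‖ := norm_pos_iff.2 hv
  rw [real_inner_smul_left]
  set i := inner ℝ v z with hi
  have hin : -(‖v‖ * ‖z‖) ≤ i := (abs_le.1 (abs_real_inner_le_norm v z)).1
  have hrw : ‖v‖ + (‖v‖⁻¹ * i + ‖z‖ ^ 2 / (2 * ‖v‖)) =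
      (‖v‖ ^ 2 + ‖v + z‖ ^ 2) / (2 * ‖v‖) := by
    rw [norm_add_sq_real]
    field_simp
    ring
  rw [hrw, le_div_iff₀ (by positivity)]
  nlinarith [sq_nonneg (‖v‖ - ‖v + z‖)]

/-- Coercivity of the gradient term: a large gradient beats all other terms. -/
theorem exists_coercivity_constant {A b₀ σ m θ C₀ C₁ : ℝ} (hA : 0 ≤ A) (hb₀ : 0 < b₀)
    (hσ : 0 < σ) (hm : 1 < m) (hC₀ : 0 ≤ C₀) :
    ∃ k : ℝ, 0 < k ∧ ∀ M : ℝ, 0 ≤ M → ∀ δ : ℝ, 0 < δ → δ ≤ 1 → ∀ P : ℝ,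
      k * (1 + M) ^ (1 / m) * δ ^ (-(max σ θ / m)) ≤ P →
      2 * A * δ ^ (-θ) + C₀ * M * δ ^ (-σ) + C₁ * P * δ ^ (σ / m - σ) < b₀ * P ^ m := by
  have hm0 : 0 < m := by linarith
  -- Half of `b₀ * P ^ m` absorbs the source and the long jumps, the other half the term linear in
  -- `P`.
  obtain ⟨k, hk0, hk1, hk2⟩ : ∃ k : ℝ, 0 < k ∧ 2 * A + C₀ < b₀ / 2 * k ^ m ∧
      C₁ ≤ b₀ / 2 * k ^ (m - 1) := by
    have e1 := ((tendsto_rpow_atTop hm0).const_mul_atTop (half_pos hb₀)).eventually_gt_atTop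
      (2 * A + C₀)
    have e2 := ((tendsto_rpow_atTop (sub_pos.2 hm)).const_mul_atTop
      (half_pos hb₀)).eventually_ge_atTop C₁
    obtain ⟨k, h1, h2, h3⟩ := ((Filter.eventually_gt_atTop 0).and (e1.and e2)).exists
    exact ⟨k, h1, h2, h3⟩
  refine ⟨k, hk0, fun M hM δ hδ hδ1 P hP => ?_⟩
  set κ := max σ θ / m with hκ
  have hκm : κ * m = max σ θ := div_mul_cancel₀ _ hm0.ne'
  have hκσ : σ / m ≤ κ := div_le_div_of_nonneg_right (le_max_left _ _) hm0.le
  set a := (1 + M) ^ (1 / m) with ha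
  have ha1 : 1 ≤ a := Real.one_le_rpow (by linarith) (by positivity)
  have ham : a ^ m = 1 + M := by
    rw [ha, ← Real.rpow_mul (by linarith), one_div_mul_cancel hm0.ne', Real.rpow_one]
  set d := δ ^ (-κ) with hd
  have hd0 : 0 < d := Real.rpow_pos_of_pos hδ _
  have hP0 : 0 < P := lt_of_lt_of_le (by positivity) hP
  have hdm : d ^ m = δ ^ (-max σ θ) := by
    rw [hd, ← Real.rpow_mul hδ.le, neg_mul, hκm]
  have h1 : k ^ m * (1 + M) * δ ^ (-max σ θ) ≤ P ^ m := by
    rw [← ham, ← hdm, ← Real.mul_rpow hk0.le (by positivity),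
      ← Real.mul_rpow (by positivity) hd0.le]
    exact Real.rpow_le_rpow (by positivity) hP hm0.le
  -- The compensator exponent `σ / m` fits here: `-(σ / m) * (m - 1) = σ / m - σ`, while `P` is at
  -- least of order `δ ^ (-(σ / m))`.
  have h2 : k ^ (m - 1) * δ ^ (σ / m - σ) ≤ P ^ (m - 1) := by
    have e : δ ^ (σ / m - σ) ≤ d ^ (m - 1) := by
      rw [hd, ← Real.rpow_mul hδ.le]
      refine Real.rpow_le_rpow_of_exponent_ge hδ hδ1 ?_
      have : σ / m * (m - 1) = σ - σ / m := by field_simp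
      nlinarith
    calc k ^ (m - 1) * δ ^ (σ / m - σ) ≤ k ^ (m - 1) * d ^ (m - 1) := by gcongr
      _ = (k * d) ^ (m - 1) := (Real.mul_rpow hk0.le hd0.le).symm
      _ ≤ P ^ (m - 1) := by
        refine Real.rpow_le_rpow (by positivity) (le_trans ?_ hP) (by linarith)
        gcongr
        exact le_mul_of_one_le_right hk0.le ha1
  have hθδ : δ ^ (-θ) ≤ δ ^ (-max σ θ) :=
    Real.rpow_le_rpow_of_exponent_ge hδ hδ1 (neg_le_neg (le_max_right _ _))
  have hσδ : δ ^ (-σ) ≤ δ ^ (-max σ θ) :=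
    Real.rpow_le_rpow_of_exponent_ge hδ hδ1 (neg_le_neg (le_max_left _ _))
  have hw0 : 0 < δ ^ (-max σ θ) := Real.rpow_pos_of_pos hδ _
  have hPm : P ^ m = P * P ^ (m - 1) := by
    rw [Real.rpow_sub_one hP0.ne', mul_div_cancel₀ _ hP0.ne']
  have t1 : 2 * A * δ ^ (-θ) + C₀ * M * δ ^ (-σ) < b₀ / 2 * P ^ m :=
    calc 2 * A * δ ^ (-θ) + C₀ * M * δ ^ (-σ)
        ≤ 2 * A * δ ^ (-max σ θ) + C₀ * M * δ ^ (-max σ θ) := by gcongr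
      _ ≤ (2 * A + C₀) * ((1 + M) * δ ^ (-max σ θ)) := by
        have : 0 ≤ (2 * A * M + C₀) * δ ^ (-max σ θ) := by positivity
        linarith
      _ < b₀ / 2 * k ^ m * ((1 + M) * δ ^ (-max σ θ)) := by gcongr
      _ = b₀ / 2 * (k ^ m * (1 + M) * δ ^ (-max σ θ)) := by ring
      _ ≤ b₀ / 2 * P ^ m := by gcongr
  have t2 : C₁ * P * δ ^ (σ / m - σ) ≤ b₀ / 2 * P ^ m :=
    calc C₁ * P * δ ^ (σ / m - σ) ≤ b₀ / 2 * k ^ (m - 1) * P * δ ^ (σ / m - σ) := by gcongr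
      _ = b₀ / 2 * (P * (k ^ (m - 1) * δ ^ (σ / m - σ))) := by ring
      _ ≤ b₀ / 2 * (P * P ^ (m - 1)) := by gcongr
      _ = b₀ / 2 * P ^ m := by rw [hPm]
  linarith

/-- If `u` violates a Hölder estimate in a ball, it is touched from above at some point by a
paraboloid with a large gradient. -/
theorem exists_touching_paraboloid {E : Type*} [NormedAddCommGroup E] [InnerProductSpace ℝ E]
    [ProperSpace E] {Ω : Set E} {u : E → ℝ} (hu : UpperSemicontinuousOn u Ω) {M : ℝ}
    (hM : ∀ x ∈ Ω, ∀ y ∈ Ω, u x - u y ≤ M) (hM0 : 0 ≤ M) {γ L r : ℝ} (hγ0 : 0 < γ) (hγ1 : γ < 1)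
    (hL : 0 < L) (hr : 0 < r) {x₀ y : E} (hy : ball y r ⊆ Ω) (hx₀ : dist x₀ y ≤ r / 2)
    (hlt : L * r ^ γ < u x₀ - u y) :
    ∃ x δ p, ball x δ ⊆ ball y r ∧ 0 < δ ∧ δ < r ∧ L * γ / 3 * δ ^ (γ - 1) ≤ ‖p‖ ∧
      ∀ w ∈ ball x δ, u w - u x ≤ inner ℝ p (w - x) + 2 * ‖p‖ / δ * ‖w - x‖ ^ 2 := by
  set φ : E → ℝ := fun w => L * (r * dist w y / (r - dist w y)) ^ γ with hφ
  set B := (M / L) ^ (1 / γ) with hB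
  have hB0 : 0 ≤ B := by positivity
  have hBγ : L * B ^ γ = M := by
    rw [hB, ← Real.rpow_mul (by positivity), one_div_mul_cancel hγ0.ne', Real.rpow_one,
      mul_div_cancel₀ _ hL.ne']
  -- Beyond `B * r / (r + B)` the barrier is at least `L * B ^ γ = M`, so a maximum of `u - φ` over
  -- this compact ball is one over the whole open ball; `r / 2` keeps `x₀` inside.
  set r' := max (r / 2) (B * r / (r + B)) with hr'
  have hr'r : r' < r := by
    refine max_lt (by linarith) ?_
    rw [div_lt_iff₀ (by positivity)]
    nlinarith
  have hsub : closedBall y r' ⊆ ball y r := closedBall_subset_ball hr'r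
  have hφM : ∀ w ∈ ball y r, w ∉ closedBall y r' → M ≤ φ w := by
    intro w hw hw'
    rw [mem_ball] at hw
    rw [mem_closedBall, not_le] at hw'
    have h1 : B * r / (r + B) < dist w y := (le_max_right _ _).trans_lt hw'
    rw [div_lt_iff₀ (by positivity)] at h1
    rw [← hBγ, hφ]
    have : B ≤ r * dist w y / (r - dist w y) := by
      rw [le_div_iff₀ (by linarith)]
      linarith
    dsimp only
    gcongr
  have hφcont : ContinuousOn φ (closedBall y r') := by
    have hd : ContinuousOn (fun w => dist w y) (closedBall y r') := by fun_prop
    refine continuousOn_const.mul (((continuousOn_const.mul hd).div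
      (continuousOn_const.sub hd) fun w hw => ?_).rpow_const fun _ _ => Or.inr hγ0.le)
    exact (sub_pos.2 (mem_ball.1 (hsub hw))).ne'
  have hx₀r' : x₀ ∈ closedBall y r' := hx₀.trans (le_max_left _ _)
  obtain ⟨x, hx, hmax⟩ := UpperSemicontinuousOn.exists_isMaxOn ⟨x₀, hx₀r'⟩
    (isCompact_closedBall y r')
    ((hu.mono (hsub.trans hy)).add hφcont.neg.upperSemicontinuousOn)
  have hφx₀ : φ x₀ ≤ L * r ^ γ := by
    have h2 : 0 < r - dist x₀ y := by linarith
    have h1 : r * dist x₀ y / (r - dist x₀ y) ≤ r := by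
      rw [div_le_iff₀ h2]
      nlinarith
    have h0 : 0 ≤ r * dist x₀ y / (r - dist x₀ y) := by positivity
    exact mul_le_mul_of_nonneg_left (Real.rpow_le_rpow h0 h1 hγ0.le) hL.le
  have hxval : u y < u x - φ x := by
    have : u x₀ + -φ x₀ ≤ u x + -φ x := hmax hx₀r'
    linarith
  have hmax' : ∀ w ∈ ball y r, u w - φ w ≤ u x - φ x := by
    intro w hw
    by_cases hw' : w ∈ closedBall y r'
    · have : u w + -φ w ≤ u x + -φ x := hmax hw'
      linarith
    · linarith [hφM w hw hw', hM w (hy hw) y (hy (mem_ball_self hr))]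
  -- The barrier is not smooth at `y`, but the maximum of `u - φ` is strictly above its value `u y`
  -- there.
  have hxy : x - y ≠ 0 := by
    intro h
    rw [sub_eq_zero] at h
    rw [h, hφ] at hxval
    simp [Real.zero_rpow hγ0.ne'] at hxval
  set ρ := ‖x - y‖ with hρ
  have hρ0 : 0 < ρ := norm_pos_iff.2 hxy
  have hρr : ρ < r := by
    rw [hρ, ← dist_eq_norm]
    exact hsub hx
  set δ := min ρ ((r - ρ) / 3) with hδ
  have hδρ : δ ≤ ρ := min_le_left _ _
  have hδr : δ ≤ (r - ρ) / 3 := min_le_right _ _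
  have hδ0 : 0 < δ := lt_min hρ0 (by linarith)
  have hballs : ball x δ ⊆ ball y r := ball_subset_ball' (by rw [dist_eq_norm]; linarith)
  set P := L * (γ * (r * ρ / (r - ρ)) ^ (γ - 1) * (r / (r - ρ)) ^ 2) with hP
  have hrρ : 0 < r - ρ := by linarith
  have hP0 : 0 ≤ P := by positivity
  have he : ‖ρ⁻¹ • (x - y)‖ = 1 := by
    rw [norm_smul, norm_inv, Real.norm_of_nonneg hρ0.le, ← hρ, inv_mul_cancel₀ hρ0.ne']
  have hpn : ‖P • (ρ⁻¹ • (x - y))‖ = P := by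
    rw [norm_smul, he, mul_one, Real.norm_of_nonneg hP0]
  refine ⟨x, δ, P • (ρ⁻¹ • (x - y)), hballs, hδ0, by linarith, ?_, fun w hw => ?_⟩
  · rw [hpn]
    have := mul_le_mul_of_nonneg_left (rpow_le_three_mul_profile_deriv hγ0 hρ0 hρr)
      (show 0 ≤ L * γ / 3 by positivity)
    refine this.trans_eq ?_
    rw [hP]
    ring
  · have hwx : ‖w - x‖ ≤ δ := by
      rw [← dist_eq_norm]
      exact (mem_ball.1 hw).le
    have hwy : dist w y ≤
        ρ + (inner ℝ (ρ⁻¹ • (x - y)) (w - x) + ‖w - x‖ ^ 2 / (2 * ρ)) := by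
      have := norm_add_le_of_inner hxy (w - x)
      rwa [show x - y + (w - x) = w - y by abel, ← dist_eq_norm] at this
    have hinner : |inner ℝ (ρ⁻¹ • (x - y)) (w - x)| ≤ ‖w - x‖ := by
      have := abs_real_inner_le_norm (ρ⁻¹ • (x - y)) (w - x)
      rwa [he, one_mul] at this
    have hprof := mul_le_mul_of_nonneg_left (rpow_profile_le hγ0 hγ1 hρ0 hρr hδ0 hδρ
      (by linarith) hinner hwx dist_nonneg hwy) hL.le
    have hφx : φ x = L * (r * ρ / (r - ρ)) ^ γ := by rw [hφ, hρ, ← dist_eq_norm]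
    have hfin : φ w ≤ φ x + P * (inner ℝ (ρ⁻¹ • (x - y)) (w - x) + 2 * ‖w - x‖ ^ 2 / δ) := by
      rw [hφx, hP]
      refine hprof.trans_eq ?_
      ring
    rw [hpn, real_inner_smul_left]
    have hm := hmax' w (hballs hw)
    have : 2 * P / δ * ‖w - x‖ ^ 2 = P * (2 * ‖w - x‖ ^ 2 / δ) := by ring
    linarith

/-! ### The Hölder estimate for subsolutions and the conclusion -/

/-- Interior Hölder estimate for bounded subsolutions, with a constant that grows sublinearly with
the oscillation. -/
theorem IsViscositySubsolution.exists_interiorHolder {N : ℕ}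
    {Ω : Set (EuclideanSpace ℝ (Fin N))} (hΩ : IsOpen Ω) (hb : Bornology.IsBounded Ω)
    {A b₀ σ m θ : ℝ} (hA : 0 ≤ A) (hb₀ : 0 < b₀) (hσ : σ ∈ Ioo (0 : ℝ) 2) (hm : max 1 σ < m)
    (hθ : θ ∈ Ico 0 m)
    {ν : EuclideanSpace ℝ (Fin N) → Measure (EuclideanSpace ℝ (Fin N))} (hM1 : CondM1 σ ν)
    (hM2 : CondM2 σ ν) (hcens : IsCensored Ω ν) :
    ∃ k : ℝ, 0 < k ∧ ∀ u : EuclideanSpace ℝ (Fin N) → ℝ,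
      IsViscositySubsolution Ω σ m θ A b₀ ν u → ∀ M : ℝ, 0 ≤ M →
      (∀ x ∈ Ω, ∀ y ∈ Ω, u x - u y ≤ M) →
      InteriorHolder Ω (1 - max σ θ / m) (k * (1 + M) ^ (1 / m)) u := by
  have hm1 : 1 < m := (le_max_left _ _).trans_lt hm
  have hσm : σ < m := (le_max_right _ _).trans_lt hm
  have hm0 : 0 < m := by linarith
  have hκ0 : 0 < max σ θ / m := div_pos (lt_max_of_lt_left hσ.1) hm0
  have hκ1 : max σ θ / m < 1 := (div_lt_one hm0).2 (max_lt hσm hθ.2)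
  obtain ⟨C₀, C₁, hC₀, -, hineq⟩ := exists_gradient_inequality (b₀ := b₀) (m := m) hΩ hb hA hσ hθ.1
    (div_pos hσ.1 hm0).le ((div_le_one hm0).2 hσm.le) (div_lt_self hσ.1 hm1) hM1 hM2 hcens
  obtain ⟨k, hk, hcoer⟩ := exists_coercivity_constant (θ := θ) (C₁ := C₁) hA hb₀ hσ.1 hm1 hC₀
  set γ := 1 - max σ θ / m with hγ
  have hγ0 : 0 < γ := by linarith
  -- With this constant, `L * γ / 3 * δ ^ (γ - 1)`, the lower bound on the touching slope, is
  -- exactly the coercivity threshold.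
  refine ⟨3 * k / γ, by positivity, fun u hu M hM huM => ?_⟩
  set L := 3 * k / γ * (1 + M) ^ (1 / m) with hL
  have hL0 : 0 < L := by
    have : 0 < (1 + M) ^ (1 / m) := Real.rpow_pos_of_pos (by linarith) _
    positivity
  have hside : ∀ x y : EuclideanSpace ℝ (Fin N), ∀ r : ℝ, 0 < r → r ≤ 1 → ball y r ⊆ Ω →
      dist x y ≤ r / 2 → u x - u y ≤ L * r ^ γ := by
    intro x y r hr hr1 hy hxy
    by_contra! hlt
    obtain ⟨x', δ, p, hsub, hδ0, hδr, hp, htouch⟩ :=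
      exists_touching_paraboloid hu.1 huM hM hγ0 (by linarith) hL0 hr hy hxy hlt
    have hball := hsub.trans hy
    have hx' := hball (mem_ball_self hδ0)
    have h1 := hineq u hu x' hx' M hM (fun w hw => huM w hw x' hx') δ ⟨hδ0, by linarith⟩ hball p
      htouch
    refine h1.not_gt (hcoer M hM δ hδ0 (by linarith) ‖p‖ (le_trans (le_of_eq ?_) hp))
    rw [hL, hγ, sub_sub_cancel_left, ← hγ]
    field_simp
  intro x y r hr hr1 hx hy hxy
  rw [abs_le]
  have h1 := hside x y r hr hr1 ((ball_subset_ball (by linarith)).trans hy) hxy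
  have h2 := hside y x r hr hr1 ((ball_subset_ball (by linarith)).trans hx) (by rwa [dist_comm])
  constructor <;> linarith

/-- Sublinear growth is absorbed: divide by `a ^ (1 / m)`. -/
theorem le_rpow_of_le_mul_rpow {m Q a : ℝ} (hm : 1 < m) (ha : 0 < a) (h : a ≤ Q * a ^ (1 / m)) :
    a ≤ Q ^ (1 / (1 - 1 / m)) := by
  have hpos : 0 < 1 - 1 / m := sub_pos.2 ((div_lt_one (by linarith)).2 hm)
  have h1 : a ^ (1 - 1 / m) ≤ Q := by
    rw [Real.rpow_sub ha, Real.rpow_one, div_le_iff₀ (Real.rpow_pos_of_pos ha _)]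
    exact h
  calc a = (a ^ (1 - 1 / m)) ^ (1 / (1 - 1 / m)) := by
        rw [← Real.rpow_mul ha.le, mul_one_div_cancel hpos.ne', Real.rpow_one]
    _ ≤ _ := Real.rpow_le_rpow (by positivity) h1 (by positivity)

theorem sub_le_osc {X : Type*} {Ω : Set X} {u : X → ℝ} (hb : Bornology.IsBounded (u '' Ω)) {x y : X}
    (hx : x ∈ Ω) (hy : y ∈ Ω) : u x - u y ≤ osc Ω u :=
  sub_le_sub (le_csSup hb.bddAbove (mem_image_of_mem u hx))
    (csInf_le hb.bddBelow (mem_image_of_mem u hy))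

theorem osc_le_of_forall_sub_le {X : Type*} {Ω : Set X} (hΩ : Ω.Nonempty) {u : X → ℝ} {K : ℝ}
    (h : ∀ x ∈ Ω, ∀ y ∈ Ω, u x - u y ≤ K) : osc Ω u ≤ K := by
  rw [osc, sub_le_iff_le_add]
  refine csSup_le (hΩ.image u) ?_
  rintro _ ⟨x, hx, rfl⟩
  rw [← sub_le_iff_le_add']
  refine le_csInf (hΩ.image u) ?_
  rintro _ ⟨y, hy, rfl⟩
  linarith [h x hx y hy]

theorem mainTheorem5 {N : ℕ} (Ω : Set (EuclideanSpace ℝ (Fin N)))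
    (hΩ_open : IsOpen Ω) (hΩ_conn : IsConnected Ω) (hΩ_bdd : Bornology.IsBounded Ω)
    (hΩ_C11 : HasC11Boundary Ω)
    (A b₀ σ m θ : ℝ) (hA : 0 < A) (hb₀ : 0 < b₀) (hσ : σ ∈ Set.Ioo (0 : ℝ) 2)
    (hm : max 1 σ < m) (hθ : θ ∈ Set.Ico 0 m)
    (ν : EuclideanSpace ℝ (Fin N) → MeasureTheory.Measure (EuclideanSpace ℝ (Fin N)))
    (hM1 : CondM1 σ ν) (hM2 : CondM2 σ ν) (hcens : IsCensored Ω ν) :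
    ∃ K > (0 : ℝ), ∀ u : EuclideanSpace ℝ (Fin N) → ℝ,
      Bornology.IsBounded (u '' Ω) → IsViscositySubsolution Ω σ m θ A b₀ ν u →
        osc Ω u ≤ K := by
  have hm1 : 1 < m := (le_max_left _ _).trans_lt hm
  have hm0 : 0 < m := by linarith
  have hγ : 0 < 1 - max σ θ / m :=
    sub_pos.2 ((div_lt_one hm0).2 (max_lt ((le_max_right _ _).trans_lt hm) hθ.2))
  obtain ⟨k, hk, hholder⟩ := IsViscositySubsolution.exists_interiorHolder hΩ_open hΩ_bdd hA.le hb₀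
    hσ hm hθ hM1 hM2 hcens
  obtain ⟨K, hK, hglob⟩ := exists_bound_of_interiorHolder hΩ_open hΩ_conn hΩ_bdd hΩ_C11 hγ
  -- The absorption is applied to `1 + osc Ω u`; the `+ 1` pays for the extra 1, as `(1 + osc Ω u) ^
  -- (1 / m) ≥ 1`.
  refine ⟨(K * k + 1) ^ (1 / (1 - 1 / m)), by positivity, fun u hub hu => ?_⟩
  have hM : 0 ≤ osc Ω u := by
    obtain ⟨a, ha⟩ := hΩ_conn.nonempty
    simpa using sub_le_osc hub ha ha
  have hpow1 : 1 ≤ (1 + osc Ω u) ^ (1 / m) := Real.one_le_rpow (by linarith) (by positivity)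
  have hu' := hholder u hu _ hM fun x hx y hy => sub_le_osc hub hx hy
  have hosc : osc Ω u ≤ K * (k * (1 + osc Ω u) ^ (1 / m)) :=
    osc_le_of_forall_sub_le hΩ_conn.nonempty fun x hx y hy =>
      (le_abs_self _).trans (hglob u _ (by positivity) hu' x hx y hy)
  have := le_rpow_of_le_mul_rpow (Q := K * k + 1) hm1 (show 0 < 1 + osc Ω u by linarith)
    (by linarith)
  linarith
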